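/- Theorem (Donoho–Stark uncertainty principle). Let $a,b,c,d,e,\gamma\in\mathbb{R}$ with $b\neq 0$ and $\gamma>-\tfrac12$. For a measurable set $S\subseteq\mathbb{R}_+=[0,\infty)$ put $|S|=\int_S s^{2\gamma+1}\,ds\in[0,\infty]$, let $\chi_S$ be its indicator function, let $L^p_\gamma(\mathbb{R}_+)$ be the complex $L^p$ space of the measure $s^{2\gamma+1}ds$ on $\mathbb{R}_+$, and let $\|\cdot\|_{\gamma,2}$ be the norm of $L^2_\gamma(\mathbb{R}_+)$. Let $$j_\gamma(x)=\Gamma(\gamma+1)\sum_{n=0}^\infty\frac{(-1)^n(x/2)^{2n}}{n!\,\Gamma(n+\gamma+1)},\qquad c_\gamma=\frac{1}{2^\gamma\Gamma(\gamma+1)}.$$ Let $\mathbb{B}=\mathbb{B}^{a,b,c}_{d,e,\gamma}$ be the quadratic-phase Fourier–Bessel transform on $L^2_\gamma(\mathbb{R}_+)$, that is, the unique continuous extension to $L^2_\gamma(\mathbb{R}_+)$ of the transform given for $h\in L^1_\gamma(\mathbb{R}_+)\cap L^2_\gamma(\mathbb{R}_+)$ by $$\mathbb{B}[h](t)=\frac{c_\gamma}{(ib)^{\gamma+1}}\int_0^\infty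 e^{-i(as^2+ct^2+ds+et)}\,j_\gamma(st/b)\,h(s)\,s^{2\gamma+1}\,ds,$$ with the principal value of the power. Let $M,N\subseteq\mathbb{R}_+$ be measurable, let $\epsilon_M,\epsilon_N$ be real numbers with $\epsilon_M+\epsilon_N\le 1$, and let $h\in L^2_\gamma(\mathbb{R}_+)$ with $\|h\|_{\gamma,2}=1$. Suppose that $h$ is $\epsilon_M$-time-limited to $M$, that is, $\|h-\chi_M h\|_{\gamma,2}\le\epsilon_M$, and $\epsilon_N$-band-limited to $N$, that is, $\|\mathbb{B}[h]-\chi_N\mathbb{B}[h]\|_{\gamma,2}\le\epsilon_N$. Then $$|M|\,|N|\;\ge\;\frac{|b|^{2(\gamma+1)}}{c_\gamma^2}\,(1-\epsilon_M-\epsilon_N)^2$$ (with the convention $0\cdot\infty=0$ on the left-hand side). -/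

import Mathlib

open MeasureTheory Filter Topology

noncomputable section

namespace QPFB

/-- The measure `s^(2γ+1) ds` on the half line. Its value on a set `M` is `|M|`, and its
`L^p` spaces are the spaces `L^p_γ(ℝ₊)`. -/
def besselMeasure (γ : ℝ) : Measure ℝ :=
  (volume.restrict (Set.Ioi 0)).withDensity (fun s => ENNReal.ofReal (s ^ (2 * γ + 1)))

/-- The normalized Bessel function
`j_γ(s) = Γ(γ+1) ∑ₙ (-1)ⁿ (s/2)^(2n) / (n! Γ(n+γ+1))`. -/
def normalizedBessel (γ s : ℝ) : ℝ :=
  Real.Gamma (γ + 1) *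
    ∑' n : ℕ, (-1 : ℝ) ^ n * (s / 2) ^ (2 * n) / ((n.factorial : ℝ) * Real.Gamma (n + γ + 1))

/-- The constant `c_γ = 1 / (2^γ Γ(γ+1))`. -/
def besselConst (γ : ℝ) : ℝ := 1 / ((2 : ℝ) ^ γ * Real.Gamma (γ + 1))

/-- The quadratic-phase Fourier–Bessel kernel
`𝕁(t,s) = exp(-i(a s² + c t² + d s + e t)) j_γ(s t / b)`. -/
def kernel (a b c d e γ t s : ℝ) : ℂ :=
  Complex.exp (-Complex.I * ((a * s ^ 2 + c * t ^ 2 + d * s + e * t : ℝ) : ℂ)) *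
    ((normalizedBessel γ (s * t / b) : ℝ) : ℂ)

/-- The quadratic-phase Fourier–Bessel transform of a function integrable with respect to
`s^(2γ+1) ds`, as an integral; the complex power is the principal one. -/
def transformL1 (a b c d e γ : ℝ) (h : ℝ → ℂ) (t : ℝ) : ℂ :=
  (besselConst γ : ℂ) / (Complex.I * (b : ℂ)) ^ ((γ : ℂ) + 1) *
    ∫ s, kernel a b c d e γ t s * h s ∂(besselMeasure γ)

/-- `F` is a value at `h` of the extension by continuity to `L²_γ` of the integral transform on
`L¹_γ ∩ L²_γ`: the pair `(h, F)` is an `L²_γ`-limit of pairs `(gₙ, 𝔹[gₙ])` with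
`gₙ ∈ L¹_γ ∩ L²_γ`. -/
def IsL2Transform (a b c d e γ : ℝ) (h F : ℝ → ℂ) : Prop :=
  MemLp F 2 (besselMeasure γ) ∧
    ∃ g : ℕ → ℝ → ℂ,
      (∀ n, MemLp (g n) 1 (besselMeasure γ) ∧ MemLp (g n) 2 (besselMeasure γ)) ∧
      Tendsto (fun n => eLpNorm (g n - h) 2 (besselMeasure γ)) atTop (𝓝 0) ∧
      Tendsto (fun n => eLpNorm (transformL1 a b c d e γ (g n) - F) 2 (besselMeasure γ))
        atTop (𝓝 0)

open Classical in
/-- The quadratic-phase Fourier–Bessel transform on `L²_γ`, a function determined up to equality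
almost everywhere on the half line. By Plancherel's theorem the first case always occurs when
`γ > -1/2`, `b ≠ 0` and `h ∈ L²_γ`. -/
def transform (a b c d e γ : ℝ) (h : ℝ → ℂ) : ℝ → ℂ :=
  if H : ∃ F : ℝ → ℂ, IsL2Transform a b c d e γ h F then Classical.choose H else 0

/-- `f` is `ε`-limited to `S`: `‖f - χ_S f‖_{γ,2} ≤ ε`. The extended norm is compared with the
real number `ε`; the clause `0 ≤ ε` is needed since `ENNReal.ofReal` truncates at zero. -/
def IsLimited (γ ε : ℝ) (S : Set ℝ) (f : ℝ → ℂ) : Prop :=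
  0 ≤ ε ∧ eLpNorm (f - S.indicator f) 2 (besselMeasure γ) ≤ ENNReal.ofReal ε

/-- `h` is `ε`-time-limited to `M`. -/
def IsTimeLimited (γ ε : ℝ) (M : Set ℝ) (h : ℝ → ℂ) : Prop := IsLimited γ ε M h

/-- `h` is `ε`-quadratic-phase Fourier–Bessel band-limited to `N`. -/
def IsBandLimited (a b c d e γ ε : ℝ) (N : Set ℝ) (h : ℝ → ℂ) : Prop :=
  IsLimited γ ε N (transform a b c d e γ h)

end QPFB

end

/-! The inequality combines two bounds on the transform: it is an isometry of `L²_γ`, and it maps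
`L¹_γ` into bounded functions with constant `K = c_γ / |b|^(γ+1)`. Put `u = χ_M h` and `F = 𝔹[h]`.
Then `1 = ‖F‖ ≤ ‖F - χ_N F‖ + ‖χ_N (F - 𝔹[u])‖ + ‖χ_N 𝔹[u]‖`. The first term is at most `εN`; the
second is at most `‖h - u‖ ≤ εM` by Plancherel; the third is at most `K ‖u‖₁ |N|^(1/2) ≤ K (|M|
|N|)^(1/2)` by Cauchy–Schwarz. Rearranging and squaring gives the claim (`one_le_add_of_isLimited`).

The sup bound needs `|j_γ| ≤ 1`, which follows from Poisson's integral
(`normalizedBessel_eq_integral`).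

Plancherel is proved with Gaussians, without an inversion formula. Up to unimodular factors the
transform is a dilated Hankel transform, which sends Gaussians to multiples of Gaussians
(`integral_normalizedBessel_mul_gaussian`). These images have the same Gram matrix as the originals,
and Gaussians are total, so some isometry extends the correspondence
(`exists_norm_eq_forall_inner_eq`). By Fubini the integral transform has the same pairings with
Gaussians as this isometry, so the two agree (`hankel_plancherel`). -/

namespace QPFB

/-! ### Determinacy by moments -/

/-- Finite measures that give a bounded function the same moments have the same image under it. -/
lemma map_eq_of_forall_integral_pow_eq {α : Type*} [MeasurableSpace α] {ν ν' : Measure α}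
    [IsFiniteMeasure ν] [IsFiniteMeasure ν'] {Y : α → ℝ} (hY : Measurable Y)
    (hY1 : ∀ s, |Y s| ≤ 1) (h : ∀ n : ℕ, ∫ s, Y s ^ n ∂ν = ∫ s, Y s ^ n ∂ν') :
    ν.map Y = ν'.map Y := by
  -- As `Y` is bounded, the complex moment generating function is an everywhere convergent power
  -- series whose coefficients are the moments.
  have key : ∀ (ρ : Measure α) [IsFiniteMeasure ρ] (z : ℂ),
      HasSum (fun n : ℕ => z ^ n / (n.factorial : ℂ) * ((∫ s, Y s ^ n ∂ρ : ℝ) : ℂ))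
        (ProbabilityTheory.complexMGF Y ρ z) := by
    intro ρ _ z
    have hb : ∀ (n : ℕ) s, ‖z ^ n / (n.factorial : ℂ) * ((Y s : ℝ) : ℂ) ^ n‖
        ≤ ‖z‖ ^ n / n.factorial := by
      intro n s
      rw [norm_mul, norm_div, norm_pow, norm_pow, Complex.norm_real, Complex.norm_natCast]
      exact mul_le_of_le_one_right (by positivity) (pow_le_one₀ (norm_nonneg _) (hY1 s))
    have hint : ∀ n : ℕ, Integrable (fun s => z ^ n / (n.factorial : ℂ) * ((Y s : ℝ) : ℂ) ^ n) ρ :=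
      fun n => Integrable.of_bound (by fun_prop) (‖z‖ ^ n / n.factorial)
        (Eventually.of_forall (hb n))
    have hs := hasSum_integral_of_summable_integral_norm hint (by
      refine Summable.of_nonneg_of_le (fun n => integral_nonneg fun _ => norm_nonneg _)
        (fun n => ?_) ((Real.summable_pow_div_factorial ‖z‖).mul_left (ρ.real Set.univ))
      calc ∫ s, ‖z ^ n / (n.factorial : ℂ) * ((Y s : ℝ) : ℂ) ^ n‖ ∂ρ
          ≤ ∫ s, ‖z‖ ^ n / n.factorial ∂ρ :=
            integral_mono (hint n).norm (integrable_const _) (hb n)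
        _ = _ := by simp)
    have h1 : (fun n : ℕ => z ^ n / (n.factorial : ℂ) * ((∫ s, Y s ^ n ∂ρ : ℝ) : ℂ)) =
        fun n : ℕ => ∫ s, z ^ n / (n.factorial : ℂ) * ((Y s : ℝ) : ℂ) ^ n ∂ρ := by
      funext n
      rw [integral_const_mul, ← integral_complex_ofReal]
      simp
    have h2 : ProbabilityTheory.complexMGF Y ρ z =
        ∫ s, ∑' n : ℕ, z ^ n / (n.factorial : ℂ) * ((Y s : ℝ) : ℂ) ^ n ∂ρ := by
      refine integral_congr_ae (Eventually.of_forall fun s => ?_)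
      simp only
      rw [Complex.exp_eq_exp_ℂ, NormedSpace.exp_eq_tsum_div]
      refine tsum_congr fun n => ?_
      rw [mul_pow]; ring
    rw [h1, h2]
    exact hs
  refine Measure.ext_of_complexMGF_eq hY.aemeasurable hY.aemeasurable (funext fun z => ?_)
  have h1 := key ν z
  simp_rw [h] at h1
  exact h1.unique (key ν' z)

/-- An integrable function whose moments against an injective bounded function vanish is zero. -/
lemma ae_eq_zero_of_forall_integral_pow_mul_eq_zero {α : Type*} [MeasurableSpace α]
    {μ : Measure α} {Y : α → ℝ} {φ : ℝ → α}
    (hY : Measurable Y) (hφ : Measurable φ) (hY1 : ∀ s, |Y s| ≤ 1)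
    (hinv : ∀ᵐ s ∂μ, φ (Y s) = s) {g : α → ℝ} (hg : Integrable g μ)
    (h : ∀ n : ℕ, ∫ s, Y s ^ n * g s ∂μ = 0) : g =ᵐ[μ] 0 := by
  -- `ENNReal.ofReal` truncates at zero, so the densities built from `g` and `-g` are the positive
  -- and negative parts of `g`. Vanishing moments mean that these two finite measures have equal
  -- moments.
  have hfin : ∀ {f : α → ℝ}, Integrable f μ →
      IsFiniteMeasure (μ.withDensity fun s => ENNReal.ofReal (f s)) :=
    fun hf => isFiniteMeasure_withDensity_ofReal hf.2
  have := hfin hg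
  have := hfin hg.neg
  have hint : ∀ {f : α → ℝ}, Integrable f μ → ∀ n : ℕ,
      ∫ s, Y s ^ n ∂(μ.withDensity fun s => ENNReal.ofReal (f s)) =
        ∫ s, max (f s) 0 * Y s ^ n ∂μ := by
    intro f hf n
    rw [integral_withDensity_eq_integral_toReal_smul₀ hf.1.aemeasurable.ennreal_ofReal
      (Eventually.of_forall fun _ => ENNReal.ofReal_lt_top)]
    simp [ENNReal.toReal_ofReal']
  have hI : ∀ {f : α → ℝ}, Integrable f μ → ∀ n : ℕ,
      Integrable (fun s => max (f s) 0 * Y s ^ n) μ := by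
    intro f hf n
    refine hf.pos_part.mul_bdd (c := 1) (by fun_prop) (Eventually.of_forall fun s => ?_)
    rw [norm_pow]
    exact pow_le_one₀ (norm_nonneg _) (hY1 s)
  have hmap := map_eq_of_forall_integral_pow_eq
    (ν := μ.withDensity fun s => ENNReal.ofReal (g s))
    (ν' := μ.withDensity fun s => ENNReal.ofReal ((-g) s)) hY hY1 (fun n => by
      rw [hint hg, hint hg.neg, ← sub_eq_zero, ← integral_sub (hI hg n) (hI hg.neg n)]
      refine Eq.trans ?_ (h n)
      refine integral_congr_ae (Eventually.of_forall fun s => ?_)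
      simp only [Pi.neg_apply]
      rcases le_total (g s) 0 with h0 | h0
      · rw [max_eq_right h0, max_eq_left (by linarith)]; ring
      · rw [max_eq_left h0, max_eq_right (by linarith)]; ring)
  -- Since `φ` inverts `Y` almost everywhere, the image under `Y` loses nothing.
  have hback : ∀ f : α → ENNReal, ((μ.withDensity f).map Y).map φ = μ.withDensity f := by
    intro f
    rw [Measure.map_map hφ hY]
    have : φ ∘ Y =ᵐ[μ.withDensity f] id :=
      (withDensity_absolutelyContinuous μ f).ae_le hinv
    rw [Measure.map_congr this, Measure.map_id]
  have hν := congrArg (Measure.map φ) hmap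
  rw [hback, hback, withDensity_eq_iff hg.1.aemeasurable.ennreal_ofReal
    hg.neg.1.aemeasurable.ennreal_ofReal hg.lintegral_lt_top.ne] at hν
  filter_upwards [hν] with s hs
  have := congrArg ENNReal.toReal hs
  simp only [ENNReal.toReal_ofReal', Pi.neg_apply] at this
  rcases le_total (g s) 0 with h0 | h0
  · rw [max_eq_right h0, max_eq_left (by linarith)] at this; simp; linarith
  · rw [max_eq_left h0, max_eq_right (by linarith)] at this; simpa using this

/-! ### The beta distribution and Poisson's integral -/

lemma measurable_betaPDF (α β : ℝ) : Measurable (ProbabilityTheory.betaPDF α β) :=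
  (ProbabilityTheory.measurable_betaPDFReal α β).ennreal_ofReal

/-- The moments of the beta distribution. -/
lemma integral_pow_betaMeasure {α β : ℝ} (hα : 0 < α) (hβ : 0 < β) (n : ℕ) :
    ∫ u, u ^ n ∂(ProbabilityTheory.betaMeasure α β) =
      ProbabilityTheory.beta (α + n) β / ProbabilityTheory.beta α β := by
  have hn : (0 : ℝ) < α + n := by positivity
  have h1 := ProbabilityTheory.beta_pos hα hβ
  have h2 := ProbabilityTheory.beta_pos hn hβ
  -- Multiplying by `u ^ n` shifts the first parameter to `α + n`; the new density has mass one, so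
  -- the moment is the ratio of normalizing constants.
  have hpt : ∀ u, ProbabilityTheory.betaPDF α β u * ENNReal.ofReal (u ^ n) =
      ENNReal.ofReal (ProbabilityTheory.beta (α + n) β / ProbabilityTheory.beta α β) *
        ProbabilityTheory.betaPDF (α + n) β u := by
    intro u
    by_cases hu : 0 < u ∧ u < 1
    · rw [ProbabilityTheory.betaPDF_of_pos_lt_one hu.1 hu.2,
        ProbabilityTheory.betaPDF_of_pos_lt_one hu.1 hu.2,
        ← ENNReal.ofReal_mul' (pow_nonneg hu.1.le n), ← ENNReal.ofReal_mul (by positivity),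
        show α + n - 1 = (α - 1) + n by ring, Real.rpow_add_natCast hu.1.ne']
      congr 1
      field_simp
    · simp [ProbabilityTheory.betaPDF_eq, hu]
  have hpos : ∀ᵐ u ∂(ProbabilityTheory.betaMeasure α β), 0 ≤ u ^ n := by
    rw [ProbabilityTheory.betaMeasure, ae_withDensity_iff
      (measurable_betaPDF α β)]
    refine Eventually.of_forall fun u hu => ?_
    by_contra h
    refine hu (ProbabilityTheory.betaPDF_eq_zero_of_nonpos ?_)
    by_contra h0
    exact h (by push Not at h0; positivity)
  rw [integral_eq_lintegral_of_nonneg_ae hpos (by fun_prop), ProbabilityTheory.betaMeasure,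
    lintegral_withDensity_eq_lintegral_mul _
      (measurable_betaPDF α β) (by fun_prop)]
  simp only [Pi.mul_apply, hpt]
  rw [lintegral_const_mul _ (measurable_betaPDF _ β),
    ProbabilityTheory.lintegral_betaPDF_eq_one hn hβ, mul_one, ENNReal.toReal_ofReal (by positivity)]

/-- The duplication formula in the form that turns the `(2n)!` of the cosine series into the `4^n
n!` of the Bessel series. -/
lemma Gamma_nat_add_half_eq (n : ℕ) :
    Real.Gamma (n + 1 / 2) * (4 ^ n * n.factorial) = (2 * n).factorial * √Real.pi := by
  induction n with
  | zero => simp [-one_div, Real.Gamma_one_half_eq]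
  | succ n ih =>
    have : (2 * (n + 1)).factorial = (2 * n + 2) * ((2 * n + 1) * (2 * n).factorial) := by
      rw [show 2 * (n + 1) = (2 * n + 1) + 1 by ring, Nat.factorial_succ, Nat.factorial_succ]
    rw [this, Nat.factorial_succ, Nat.cast_succ,
      show (n : ℝ) + 1 + 1 / 2 = (n + 1 / 2) + 1 by ring,
      Real.Gamma_add_one (by positivity)]
    push_cast
    linear_combination (2 * (n : ℝ) + 2) * (2 * n + 1) * ih

/-- Poisson's integral: the normalized Bessel function is a mean of cosines. -/
lemma normalizedBessel_eq_integral {γ : ℝ} (hγ : -1 / 2 < γ) (x : ℝ) :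
    normalizedBessel γ x =
      ∫ u, Real.cos (x * √u) ∂(ProbabilityTheory.betaMeasure (1 / 2) (γ + 1 / 2)) := by
  have hβ : 0 < γ + 1 / 2 := by linarith
  have hα : (0 : ℝ) < 1 / 2 := by norm_num
  have := ProbabilityTheory.isProbabilityMeasureBeta hα hβ
  set ρ := ProbabilityTheory.betaMeasure (1 / 2) (γ + 1 / 2)
  have hmem : ∀ᵐ u ∂ρ, 0 < u ∧ u < 1 := by
    rw [show ρ = volume.withDensity _ from rfl, ae_withDensity_iff (measurable_betaPDF _ _)]
    refine Eventually.of_forall fun u hu => ?_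
    by_contra h
    exact hu (by simp only [ProbabilityTheory.betaPDF_eq, if_neg h, ENNReal.ofReal_zero])
  have hb : ∀ n : ℕ, ∀ᵐ u ∂ρ, ‖(-1) ^ n * x ^ (2 * n) / ((2 * n).factorial : ℝ) * u ^ n‖
      ≤ |x| ^ (2 * n) / (2 * n).factorial := by
    intro n
    filter_upwards [hmem] with u hu
    rw [norm_mul, norm_div, norm_mul, norm_pow, norm_pow, norm_neg, norm_one, one_pow, one_mul,
      Real.norm_natCast, Real.norm_eq_abs, norm_pow]
    refine mul_le_of_le_one_right (by positivity) (pow_le_one₀ (norm_nonneg _) ?_)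
    rw [Real.norm_eq_abs, abs_of_pos hu.1]
    exact hu.2.le
  have hint : ∀ n : ℕ,
      Integrable (fun u => (-1) ^ n * x ^ (2 * n) / ((2 * n).factorial : ℝ) * u ^ n) ρ :=
    fun n => Integrable.of_bound (by fun_prop) _ (hb n)
  have hs := hasSum_integral_of_summable_integral_norm hint (by
    refine Summable.of_nonneg_of_le (fun n => integral_nonneg fun _ => norm_nonneg _)
      (fun n => ?_) ((Real.summable_pow_div_factorial |x|).comp_injective
        (mul_right_injective₀ (two_ne_zero : (2 : ℕ) ≠ 0)))
    calc _ ≤ ∫ u, |x| ^ (2 * n) / (2 * n).factorial ∂ρ :=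
            integral_mono_ae (hint n).norm (integrable_const _) (hb n)
        _ = _ := by simp)
  have hcos : ∫ u, Real.cos (x * √u) ∂ρ =
      ∫ u, (∑' n : ℕ, (-1) ^ n * x ^ (2 * n) / ((2 * n).factorial : ℝ) * u ^ n) ∂ρ := by
    refine integral_congr_ae ?_
    filter_upwards [hmem] with u hu
    rw [Real.cos_eq_tsum]
    refine tsum_congr fun n => ?_
    rw [mul_pow, pow_mul (√u), Real.sq_sqrt hu.1.le]
    ring
  rw [hcos, ← hs.tsum_eq, normalizedBessel, ← tsum_mul_left]
  refine tsum_congr fun n => ?_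
  rw [integral_const_mul, integral_pow_betaMeasure hα hβ, ProbabilityTheory.beta,
    ProbabilityTheory.beta, show (1 : ℝ) / 2 + n + (γ + 1 / 2) = n + γ + 1 by ring,
    show (1 : ℝ) / 2 + (γ + 1 / 2) = γ + 1 by ring, Real.Gamma_one_half_eq, add_comm (1 / 2 : ℝ)]
  have h1 : Real.Gamma (γ + 1 / 2) ≠ 0 := (Real.Gamma_pos_of_pos hβ).ne'
  have h2 : Real.Gamma (γ + 1) ≠ 0 := (Real.Gamma_pos_of_pos (by linarith)).ne'
  have h3 : Real.Gamma (n + γ + 1) ≠ 0 :=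
    (Real.Gamma_pos_of_pos (by have := n.cast_nonneg (α := ℝ); linarith)).ne'
  have h4 : √Real.pi ≠ 0 := by positivity
  have h5 := Gamma_nat_add_half_eq n
  rw [← eq_div_iff (by positivity)] at h5
  rw [h5, div_pow, pow_mul 2]
  norm_num
  rw [show γ + 1 / 2 = (γ * 2 + 1) / 2 by ring] at h1
  field_simp

/-- A mean of cosines against a probability measure. The beta parameter `γ + 1/2` must be positive,
whence the condition on `γ`. -/
lemma abs_normalizedBessel_le_one {γ : ℝ} (hγ : -1 / 2 < γ) (x : ℝ) :
    |normalizedBessel γ x| ≤ 1 := by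
  have := ProbabilityTheory.isProbabilityMeasureBeta (α := 1 / 2) (β := γ + 1 / 2)
    (by norm_num) (by linarith)
  rw [normalizedBessel_eq_integral hγ, ← Real.norm_eq_abs]
  refine (norm_integral_le_of_norm_le_const (C := 1)
    (Eventually.of_forall fun u => Real.abs_cos_le_one _)).trans ?_
  rw [probReal_univ, one_mul]

lemma continuous_normalizedBessel {γ : ℝ} (hγ : -1 / 2 < γ) :
    Continuous (normalizedBessel γ) := by
  have := ProbabilityTheory.isProbabilityMeasureBeta (α := 1 / 2) (β := γ + 1 / 2)
    (by norm_num) (by linarith)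
  rw [funext (normalizedBessel_eq_integral hγ)]
  exact continuous_of_dominated (bound := fun _ => 1) (fun x => by fun_prop)
    (fun x => Eventually.of_forall fun u => Real.abs_cos_le_one _) (integrable_const _)
    (Eventually.of_forall fun u => by fun_prop)

/-! ### The weighted measure and Gaussian integrals -/

lemma measurable_rpow_weight (γ : ℝ) :
    Measurable fun s : ℝ => ENNReal.ofReal (s ^ (2 * γ + 1)) := by fun_prop

lemma ae_pos_besselMeasure (γ : ℝ) : ∀ᵐ s ∂(besselMeasure γ), 0 < s :=
  (withDensity_absolutelyContinuous _ _).ae_le (ae_restrict_mem measurableSet_Ioi)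

lemma integral_besselMeasure {E : Type*} [NormedAddCommGroup E] [NormedSpace ℝ E] (γ : ℝ)
    (f : ℝ → E) :
    ∫ s, f s ∂(besselMeasure γ) = ∫ s in Set.Ioi 0, s ^ (2 * γ + 1) • f s := by
  rw [besselMeasure, integral_withDensity_eq_integral_toReal_smul (measurable_rpow_weight γ)
    (Eventually.of_forall fun _ => ENNReal.ofReal_lt_top)]
  refine setIntegral_congr_fun measurableSet_Ioi fun s hs => ?_
  rw [ENNReal.toReal_ofReal (Real.rpow_nonneg (le_of_lt hs) _)]

lemma integrable_besselMeasure_iff {E : Type*} [NormedAddCommGroup E] [NormedSpace ℝ E] (γ : ℝ)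
    (f : ℝ → E) :
    Integrable f (besselMeasure γ) ↔ IntegrableOn (fun s => s ^ (2 * γ + 1) • f s) (Set.Ioi 0) := by
  rw [besselMeasure, integrable_withDensity_iff_integrable_smul' (measurable_rpow_weight γ)
    (Eventually.of_forall fun _ => ENNReal.ofReal_lt_top), IntegrableOn]
  refine integrable_congr ?_
  filter_upwards [ae_restrict_mem measurableSet_Ioi] with s hs
  rw [ENNReal.toReal_ofReal (Real.rpow_nonneg (le_of_lt hs) _)]

instance sigmaFinite_besselMeasure (γ : ℝ) : SigmaFinite (besselMeasure γ) :=
  SigmaFinite.withDensity_of_ne_top (Eventually.of_forall fun _ => ENNReal.ofReal_ne_top)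

/-- The Gaussian `exp(-p s² / 2)`. -/
noncomputable def gaussian (p s : ℝ) : ℝ := Real.exp (-(p / 2) * s ^ 2)

lemma gaussian_pos (p s : ℝ) : 0 < gaussian p s := Real.exp_pos _

lemma gaussian_mul (p q s : ℝ) : gaussian p s * gaussian q s = gaussian (p + q) s := by
  rw [gaussian, gaussian, gaussian, ← Real.exp_add]; ring_nf

lemma gaussian_pow (p s : ℝ) (n : ℕ) : gaussian p s ^ n = gaussian (n * p) s := by
  rw [gaussian, gaussian, ← Real.exp_nat_mul]; ring_nf

lemma gaussian_le_one {p : ℝ} (hp : 0 ≤ p) (s : ℝ) : gaussian p s ≤ 1 :=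
  Real.exp_le_one_iff.2 (by nlinarith [sq_nonneg s, mul_nonneg hp (sq_nonneg s)])

@[fun_prop]
lemma continuous_gaussian (p : ℝ) : Continuous (gaussian p) := by unfold gaussian; fun_prop

lemma pow_mul_gaussian_weight (γ p : ℝ) (n : ℕ) {s : ℝ} (hs : 0 < s) :
    s ^ (2 * γ + 1) • (s ^ (2 * n) * gaussian p s) =
      s ^ (2 * (n + γ) + 1) * Real.exp (-(p / 2) * s ^ (2 : ℝ)) := by
  rw [gaussian, smul_eq_mul, ← mul_assoc, ← Real.rpow_add_natCast hs.ne', Real.rpow_two]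
  push_cast
  ring_nf

lemma integrable_pow_mul_gaussian {γ p : ℝ} (hγ : -1 < γ) (hp : 0 < p) (n : ℕ) :
    Integrable (fun s => s ^ (2 * n) * gaussian p s) (besselMeasure γ) := by
  have hn := n.cast_nonneg (α := ℝ)
  rw [integrable_besselMeasure_iff]
  exact (integrableOn_rpow_mul_exp_neg_mul_rpow (s := 2 * (n + γ) + 1) (by linarith) two_pos
    (half_pos hp)).congr_fun (fun s hs => (pow_mul_gaussian_weight γ p n hs).symm)
    measurableSet_Ioi

lemma integral_pow_mul_gaussian {γ p : ℝ} (hγ : -1 < γ) (hp : 0 < p) (n : ℕ) :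
    ∫ s, s ^ (2 * n) * gaussian p s ∂(besselMeasure γ) =
      (2 / p) ^ n * Real.Gamma (n + γ + 1) * (2 ^ γ * p ^ (-(γ + 1))) := by
  have hn := n.cast_nonneg (α := ℝ)
  rw [integral_besselMeasure, setIntegral_congr_fun measurableSet_Ioi
    (fun s hs => pow_mul_gaussian_weight γ p n hs), integral_rpow_mul_exp_neg_mul_rpow two_pos
    (by linarith) (half_pos hp), show -(2 * (n + γ) + 1 + 1) / 2 = -(γ + 1) + -(n : ℝ) by ring,
    show (2 * (n + γ) + 1 + 1) / 2 = n + γ + 1 by ring, Real.rpow_add (half_pos hp),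
    Real.rpow_neg (half_pos hp).le (n : ℝ), Real.rpow_natCast, Real.div_rpow hp.le two_pos.le,
    Real.rpow_neg two_pos.le, Real.rpow_add two_pos, Real.rpow_one, div_pow, div_pow]
  have : (2 : ℝ) ^ γ ≠ 0 := (Real.rpow_pos_of_pos two_pos _).ne'
  field_simp

lemma integrable_gaussian {γ p : ℝ} (hγ : -1 < γ) (hp : 0 < p) :
    Integrable (gaussian p) (besselMeasure γ) := by
  simpa using integrable_pow_mul_gaussian hγ hp 0

lemma integral_gaussian {γ p : ℝ} (hγ : -1 < γ) (hp : 0 < p) :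
    ∫ s, gaussian p s ∂(besselMeasure γ) = p ^ (-(γ + 1)) / besselConst γ := by
  have h := integral_pow_mul_gaussian hγ hp 0
  simp only [mul_zero, pow_zero, one_mul, Nat.cast_zero, zero_add] at h
  rw [h, besselConst]
  field_simp

/-- Weber's integral: the Hankel transform of a Gaussian is a Gaussian. -/
lemma integral_normalizedBessel_mul_gaussian {γ p : ℝ} (hγ : -1 < γ) (hp : 0 < p) (t : ℝ) :
    ∫ s, normalizedBessel γ (s * t) * gaussian p s ∂(besselMeasure γ) =
      p ^ (-(γ + 1)) / besselConst γ * gaussian (1 / p) t := by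
  have hΓ : ∀ n : ℕ, 0 < Real.Gamma (n + γ + 1) := fun n =>
    Real.Gamma_pos_of_pos (by have := n.cast_nonneg (α := ℝ); linarith)
  set c : ℕ → ℝ := fun n =>
    (-1) ^ n * (t / 2) ^ (2 * n) / ((n.factorial : ℝ) * Real.Gamma (n + γ + 1)) with hc
  set K := 2 ^ γ * p ^ (-(γ + 1)) with hK
  -- The moment's factor `Γ(n+γ+1)` cancels the one in the Bessel series, leaving the exponential
  -- series of `-t²/(2p)`.
  have hval : ∀ n, c n * ((2 / p) ^ n * Real.Gamma (n + γ + 1) * K) =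
      (-(1 / p / 2) * t ^ 2) ^ n / n.factorial * K := by
    intro n
    have h1 := (hΓ n).ne'
    have h2 : (-(1 / p / 2) * t ^ 2) ^ n = (-1) ^ n * (t / 2) ^ (2 * n) * (2 / p) ^ n := by
      rw [pow_mul, ← mul_pow, ← mul_pow]; congr 1; field_simp
    rw [h2, hc]
    field_simp
  have hint : ∀ n, Integrable (fun s => c n * (s ^ (2 * n) * gaussian p s)) (besselMeasure γ) :=
    fun n => (integrable_pow_mul_gaussian hγ hp n).const_mul _
  have hs := hasSum_integral_of_summable_integral_norm hint (by
    have hn : ∀ n, ∫ s, ‖c n * (s ^ (2 * n) * gaussian p s)‖ ∂(besselMeasure γ) =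
        |-(1 / p / 2) * t ^ 2| ^ n / n.factorial * |K| := by
      intro n
      have : ∀ s, ‖c n * (s ^ (2 * n) * gaussian p s)‖ = |c n| * (s ^ (2 * n) * gaussian p s) := by
        intro s
        rw [norm_mul, Real.norm_eq_abs, Real.norm_eq_abs, abs_of_nonneg (a := _ * _)]
        rw [pow_mul]
        exact mul_nonneg (pow_nonneg (sq_nonneg s) n) (gaussian_pos p s).le
      simp_rw [this]
      rw [integral_const_mul, integral_pow_mul_gaussian hγ hp]
      have h3 := congrArg abs (hval n)
      rw [abs_mul (c n), abs_mul (_ / _) K, abs_div (_ ^ n) (n.factorial : ℝ), abs_pow (_ * _) n,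
        Nat.abs_cast, abs_of_nonneg (a := _ * K)] at h3
      · exact h3
      · have := hΓ n
        positivity
    simp_rw [hn]
    exact (Real.summable_pow_div_factorial _).mul_right _)
  have h1 : ∀ s, normalizedBessel γ (s * t) * gaussian p s =
      Real.Gamma (γ + 1) * ∑' n, c n * (s ^ (2 * n) * gaussian p s) := by
    intro s
    rw [normalizedBessel, mul_assoc, ← tsum_mul_right]
    congr 1
    refine tsum_congr fun n => ?_
    simp only [hc]
    rw [show s * t / 2 = s * (t / 2) by ring, mul_pow]
    ring
  simp_rw [h1]
  rw [integral_const_mul, ← hs.tsum_eq]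
  simp_rw [integral_const_mul, integral_pow_mul_gaussian hγ hp]
  rw [← hK]
  simp_rw [hval]
  rw [tsum_mul_right, gaussian, Real.exp_eq_exp_ℝ, NormedSpace.exp_eq_tsum_div, besselConst, hK]
  field_simp

/-! ### Gaussians as a total family in `L²_γ` -/

/-- A function is determined by its integrals against Gaussians. -/
lemma ae_eq_zero_of_forall_integral_gaussian_mul_eq_zero {γ : ℝ} {f : ℝ → ℂ}
    (hf : Integrable (fun s => (gaussian 1 s : ℂ) * f s) (besselMeasure γ))
    (h : ∀ q, 0 < q → ∫ s, (gaussian q s : ℂ) * f s ∂(besselMeasure γ) = 0) :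
    f =ᵐ[besselMeasure γ] 0 := by
  have hinv : ∀ᵐ s ∂(besselMeasure γ), √(-2 * Real.log (gaussian 1 s)) = s := by
    filter_upwards [ae_pos_besselMeasure γ] with s hs
    rw [gaussian, Real.log_exp, show -2 * (-(1 / 2) * s ^ 2) = s ^ 2 by ring,
      Real.sqrt_sq hs.le]
  have hb : ∀ s, |gaussian 1 s| ≤ 1 := fun s => by
    rw [abs_of_pos (gaussian_pos _ _)]; exact gaussian_le_one zero_le_one s
  have hφ : Measurable fun y : ℝ => √(-2 * Real.log y) := by fun_prop
  have hY : Measurable (gaussian 1) := (continuous_gaussian 1).measurable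
  -- Powers of `gaussian 1` are again Gaussians. One factor stays with `f` to make it integrable;
  -- the others supply the moments.
  have hC : ∀ n : ℕ, ∫ s, ((gaussian 1 s ^ n : ℝ) : ℂ) * ((gaussian 1 s : ℂ) * f s)
      ∂(besselMeasure γ) = 0 := by
    intro n
    rw [← h (n * 1 + 1) (by positivity)]
    congr 1 with s
    rw [← gaussian_mul, ← gaussian_pow]
    push_cast
    ring
  have hI : ∀ n : ℕ, Integrable
      (fun s => ((gaussian 1 s ^ n : ℝ) : ℂ) * ((gaussian 1 s : ℂ) * f s)) (besselMeasure γ) := by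
    intro n
    refine hf.bdd_mul (c := 1) (by fun_prop) (Eventually.of_forall fun s => ?_)
    rw [Complex.norm_real, norm_pow]
    exact pow_le_one₀ (norm_nonneg _) (hb s)
  have hre := ae_eq_zero_of_forall_integral_pow_mul_eq_zero hY hφ hb hinv hf.re (fun n => by
    have := congrArg Complex.re (hC n)
    rw [← RCLike.re_to_complex, ← integral_re (hI n)] at this
    simpa only [RCLike.re_to_complex, Complex.re_ofReal_mul, Complex.zero_re] using this)
  have him := ae_eq_zero_of_forall_integral_pow_mul_eq_zero hY hφ hb hinv hf.im (fun n => by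
    have := congrArg Complex.im (hC n)
    rw [← RCLike.im_to_complex, ← integral_im (hI n)] at this
    simpa only [RCLike.im_to_complex, Complex.im_ofReal_mul, Complex.zero_im] using this)
  filter_upwards [hre, him] with s h1 h2
  have : (gaussian 1 s : ℂ) * f s = 0 := Complex.ext h1 h2
  exact (mul_eq_zero.1 this).resolve_left (by exact_mod_cast (gaussian_pos 1 s).ne')

/-- Two families with the same Gram matrix and symmetric mixed Gram matrix, the first total: the
isometry that takes one to the other, evaluated at `g`. -/
lemma exists_norm_eq_forall_inner_eq {ι V : Type*} [NormedAddCommGroup V] [InnerProductSpace ℂ V]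
    [CompleteSpace V] {e e' : ι → V} (hGram : ∀ i j, inner ℂ (e i) (e j) = inner ℂ (e' i) (e' j))
    (hsymm : ∀ i j, inner ℂ (e i) (e' j) = inner ℂ (e' i) (e j))
    (htotal : ∀ v, (∀ i, inner ℂ (e i) v = 0) → v = 0) (g : V) :
    ∃ F : V, ‖F‖ = ‖g‖ ∧ ∀ i, inner ℂ (e i) F = inner ℂ (e' i) g := by
  set A := Finsupp.linearCombination ℂ e with hA
  set B := Finsupp.linearCombination ℂ e' with hB
  -- Equal Gram matrices make `A x ↦ B x` isometric. Approximating `g` by `A (x n)`, the vector `F`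
  -- is the limit of `B (x n)`, and the mixed symmetry identifies its inner products.
  have hnorm : ∀ x, ‖B x‖ = ‖A x‖ := by
    intro x
    rw [@norm_eq_sqrt_re_inner ℂ, @norm_eq_sqrt_re_inner ℂ, hA, hB]
    simp only [Finsupp.linearCombination_apply, Finsupp.sum_inner, Finsupp.inner_sum,
      inner_smul_left, inner_smul_right, hGram]
  have hAB : ∀ i x, inner ℂ (e i) (B x) = inner ℂ (e' i) (A x) := by
    intro i x
    rw [hA, hB]
    simp only [Finsupp.linearCombination_apply, Finsupp.inner_sum, inner_smul_right, hsymm]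
  have hdense : (LinearMap.range A).topologicalClosure = ⊤ := by
    rw [Submodule.topologicalClosure_eq_top_iff, Submodule.eq_bot_iff]
    intro v hv
    refine htotal v fun i => ?_
    have := (Submodule.mem_orthogonal _ v).1 hv (A (Finsupp.single i 1)) ⟨_, rfl⟩
    simpa [hA] using this
  have hg : g ∈ closure (LinearMap.range A : Set V) := by
    rw [← Submodule.topologicalClosure_coe, hdense]; trivial
  obtain ⟨y, hy, hlim⟩ := mem_closure_iff_seq_limit.1 hg
  choose x hx using hy
  have hcauchy : CauchySeq fun n => B (x n) := by
    have h1 := hlim.cauchySeq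
    rw [Metric.cauchySeq_iff] at h1 ⊢
    intro ε hε
    obtain ⟨N, hN⟩ := h1 ε hε
    refine ⟨N, fun m hm n hn => ?_⟩
    rw [dist_eq_norm, ← map_sub, hnorm, map_sub, hx, hx, ← dist_eq_norm]
    exact hN m hm n hn
  obtain ⟨F, hF⟩ := cauchySeq_tendsto_of_complete hcauchy
  refine ⟨F, tendsto_nhds_unique hF.norm ?_, fun i =>
    tendsto_nhds_unique (tendsto_const_nhds.inner hF) ?_⟩
  · simpa only [hnorm, hx] using hlim.norm
  · simpa only [hAB, hx] using (tendsto_const_nhds (x := e' i)).inner hlim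

lemma memLp_gaussian {γ p : ℝ} (hγ : -1 < γ) (hp : 0 < p) :
    MemLp (fun s => (gaussian p s : ℂ)) 2 (besselMeasure γ) := by
  refine (memLp_two_iff_integrable_sq_norm
    (by fun_prop : Continuous fun s => (gaussian p s : ℂ)).aestronglyMeasurable).2 ?_
  refine (integrable_gaussian hγ (by positivity : 0 < p + p)).congr
    (Eventually.of_forall fun s => ?_)
  simp only
  rw [Complex.norm_real, Real.norm_eq_abs, sq_abs, sq, gaussian_mul]

/-- The Gaussian as an element of `L²_γ`. -/
noncomputable def gaussianLp {γ : ℝ} (hγ : -1 < γ) (p : Set.Ioi (0 : ℝ)) :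
    Lp ℂ 2 (besselMeasure γ) :=
  (memLp_gaussian hγ p.2).toLp _

lemma inner_gaussianLp {γ : ℝ} (hγ : -1 < γ) (p : Set.Ioi (0 : ℝ)) (v : Lp ℂ 2 (besselMeasure γ)) :
    inner ℂ (gaussianLp hγ p) v = ∫ s, (gaussian p s : ℂ) * v s ∂(besselMeasure γ) := by
  rw [L2.inner_def]
  refine integral_congr_ae ?_
  filter_upwards [(memLp_gaussian hγ p.2).coeFn_toLp] with s hs
  rw [gaussianLp, hs, RCLike.inner_apply, Complex.conj_ofReal, mul_comm]

/-- The Gram matrix depends only on `p + q`, which reduces the Gram conditions for Plancherel to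
rational identities. -/
lemma inner_gaussianLp_gaussianLp {γ : ℝ} (hγ : -1 < γ) (p q : Set.Ioi (0 : ℝ)) :
    inner ℂ (gaussianLp hγ p) (gaussianLp hγ q) =
      (((p + q : ℝ) ^ (-(γ + 1)) / besselConst γ : ℝ) : ℂ) := by
  rw [inner_gaussianLp, ← integral_gaussian hγ (add_pos p.2 q.2), ← integral_complex_ofReal]
  refine integral_congr_ae ?_
  filter_upwards [(memLp_gaussian hγ q.2).coeFn_toLp] with s hs
  rw [gaussianLp, hs, ← gaussian_mul]
  push_cast
  rfl

lemma integrable_gaussian_mul {γ p : ℝ} (hγ : -1 < γ) (hp : 0 < p) {f : ℝ → ℂ}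
    (hf : MemLp f 2 (besselMeasure γ)) :
    Integrable (fun s => (gaussian p s : ℂ) * f s) (besselMeasure γ) :=
  (memLp_gaussian hγ hp).integrable_mul hf

lemma eq_zero_of_forall_inner_gaussianLp_eq_zero {γ : ℝ} (hγ : -1 < γ)
    (v : Lp ℂ 2 (besselMeasure γ)) (h : ∀ p, inner ℂ (gaussianLp hγ p) v = 0) : v = 0 := by
  rw [Lp.eq_zero_iff_ae_eq_zero]
  refine ae_eq_zero_of_forall_integral_gaussian_mul_eq_zero
    (integrable_gaussian_mul hγ one_pos (Lp.memLp v)) fun q hq => ?_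
  rw [← h ⟨q, hq⟩, inner_gaussianLp]

/-! ### The Hankel transform and its Plancherel theorem -/

lemma besselConst_pos {γ : ℝ} (hγ : -1 < γ) : 0 < besselConst γ := by
  have := Real.Gamma_pos_of_pos (by linarith : 0 < γ + 1)
  unfold besselConst
  positivity

/-- The Hankel transform of order `γ`, dilated by `b`, without its normalizing constant. -/
noncomputable def hankel (γ b : ℝ) (g : ℝ → ℂ) (t : ℝ) : ℂ :=
  ∫ s, (normalizedBessel γ (s * t / b) : ℂ) * g s ∂(besselMeasure γ)

lemma norm_normalizedBessel_mul_le {γ : ℝ} (hγ : -1 / 2 < γ) (x : ℝ) (z : ℂ) :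
    ‖(normalizedBessel γ x : ℂ) * z‖ ≤ ‖z‖ := by
  rw [norm_mul, Complex.norm_real]
  exact mul_le_of_le_one_left (norm_nonneg _) (abs_normalizedBessel_le_one hγ _)

lemma integrable_normalizedBessel_mul {γ : ℝ} (hγ : -1 / 2 < γ) (b t : ℝ) {g : ℝ → ℂ}
    (hg : Integrable g (besselMeasure γ)) :
    Integrable (fun s => (normalizedBessel γ (s * t / b) : ℂ) * g s) (besselMeasure γ) := by
  have := continuous_normalizedBessel hγ
  exact hg.mono ((by fun_prop : Continuous fun s =>
    (normalizedBessel γ (s * t / b) : ℂ)).aestronglyMeasurable.mul hg.1)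
    (Eventually.of_forall fun s => norm_normalizedBessel_mul_le hγ _ _)

lemma norm_hankel_le {γ : ℝ} (hγ : -1 / 2 < γ) (b t : ℝ) {g : ℝ → ℂ}
    (hg : Integrable g (besselMeasure γ)) :
    ‖hankel γ b g t‖ ≤ ∫ s, ‖g s‖ ∂(besselMeasure γ) :=
  norm_integral_le_of_norm_le hg.norm
    (Eventually.of_forall fun _ => norm_normalizedBessel_mul_le hγ _ _)

lemma continuous_hankel {γ : ℝ} (hγ : -1 / 2 < γ) (b : ℝ) {g : ℝ → ℂ}
    (hg : Integrable g (besselMeasure γ)) : Continuous (hankel γ b g) := by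
  have := continuous_normalizedBessel hγ
  exact continuous_of_dominated (fun t => (integrable_normalizedBessel_mul hγ b t hg).1)
    (fun t => Eventually.of_forall fun s => norm_normalizedBessel_mul_le hγ _ _) hg.norm
    (Eventually.of_forall fun s => by fun_prop)

/-- The Hankel transform is symmetric; against a Gaussian the transform is explicit. -/
lemma integral_gaussian_mul_hankel {γ b q : ℝ} (hγ : -1 / 2 < γ) (hb : b ≠ 0) (hq : 0 < q)
    {g : ℝ → ℂ} (hg : Integrable g (besselMeasure γ)) :
    ∫ t, (gaussian q t : ℂ) * hankel γ b g t ∂(besselMeasure γ) =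
      ((q ^ (-(γ + 1)) / besselConst γ : ℝ) : ℂ) *
        ∫ s, (gaussian (1 / (q * b ^ 2)) s : ℂ) * g s ∂(besselMeasure γ) := by
  have hγ1 : -1 < γ := by linarith
  have hj := continuous_normalizedBessel hγ
  have hG : Integrable (fun t => (gaussian q t : ℂ)) (besselMeasure γ) :=
    (integrable_gaussian hγ1 hq).ofReal
  -- The bound `|j_γ| ≤ 1` gives the integrability on the product that Fubini requires.
  have hint : Integrable (fun z : ℝ × ℝ => (normalizedBessel γ (z.2 * z.1 / b) : ℂ) *
      ((gaussian q z.1 : ℂ) * g z.2)) ((besselMeasure γ).prod (besselMeasure γ)) :=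
    (hG.mul_prod hg).mono ((by fun_prop : Continuous fun z : ℝ × ℝ =>
      (normalizedBessel γ (z.2 * z.1 / b) : ℂ)).aestronglyMeasurable.mul (hG.mul_prod hg).1)
      (Eventually.of_forall fun z => norm_normalizedBessel_mul_le hγ _ _)
  calc ∫ t, (gaussian q t : ℂ) * hankel γ b g t ∂(besselMeasure γ)
      = ∫ t, ∫ s, (normalizedBessel γ (s * t / b) : ℂ) * ((gaussian q t : ℂ) * g s)
          ∂(besselMeasure γ) ∂(besselMeasure γ) := by
        refine integral_congr_ae (Eventually.of_forall fun t => ?_)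
        simp only [hankel]
        rw [← integral_const_mul]
        congr 1 with s
        ring
    _ = ∫ s, ∫ t, (normalizedBessel γ (s * t / b) : ℂ) * ((gaussian q t : ℂ) * g s)
          ∂(besselMeasure γ) ∂(besselMeasure γ) := integral_integral_swap hint
    _ = ∫ s, ((q ^ (-(γ + 1)) / besselConst γ : ℝ) : ℂ) *
          ((gaussian (1 / (q * b ^ 2)) s : ℂ) * g s) ∂(besselMeasure γ) := by
        refine integral_congr_ae (Eventually.of_forall fun s => ?_)
        have h1 := integral_normalizedBessel_mul_gaussian hγ1 hq (s / b)
        have h2 : gaussian (1 / q) (s / b) = gaussian (1 / (q * b ^ 2)) s := by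
          rw [gaussian, gaussian]; congr 1; field_simp
        rw [h2] at h1
        simp only
        rw [← mul_assoc, ← Complex.ofReal_mul, ← h1, ← integral_complex_ofReal,
          ← integral_mul_const]
        congr 1 with t
        rw [show t * (s / b) = s * t / b by ring]
        push_cast
        ring
    _ = _ := integral_const_mul _ _

/-- Plancherel's theorem for the Hankel transform. -/
theorem hankel_plancherel {γ b : ℝ} (hγ : -1 / 2 < γ) (hb : b ≠ 0) {g : ℝ → ℂ}
    (h1 : Integrable g (besselMeasure γ)) (h2 : MemLp g 2 (besselMeasure γ)) :
    eLpNorm (fun t => ((besselConst γ / |b| ^ (γ + 1) : ℝ) : ℂ) * hankel γ b g t) 2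
      (besselMeasure γ) = eLpNorm g 2 (besselMeasure γ) := by
  have hγ1 : -1 < γ := by linarith
  have hc := besselConst_pos hγ1
  have hb' : 0 < |b| := abs_pos.2 hb
  have hr : ∀ p : Set.Ioi (0 : ℝ), (0 : ℝ) < 1 / (p * b ^ 2) := fun p => by
    have := p.2.out; positivity
  let r : Set.Ioi (0 : ℝ) → Set.Ioi (0 : ℝ) := fun p => ⟨1 / (p * b ^ 2), hr p⟩
  -- By Weber's integral, this is the normalized Hankel transform of `gaussian p`. The Gram identity
  -- below is `|b|p · |b|q · (1/(pb²) + 1/(qb²)) = p + q`; the mixed one is the symmetry of `|b|pq +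
  -- 1/|b|`.
  let e' : Set.Ioi (0 : ℝ) → Lp ℂ 2 (besselMeasure γ) := fun p =>
    (((|b| * p) ^ (-(γ + 1)) : ℝ) : ℂ) • gaussianLp hγ1 (r p)
  have hsq : b ^ 2 = |b| ^ 2 := (sq_abs b).symm
  obtain ⟨F, hFn, hF⟩ := exists_norm_eq_forall_inner_eq (e := gaussianLp hγ1) (e' := e')
    (fun p q => by
      have hp := p.2.out
      have hq := q.2.out
      simp only [e', inner_smul_left, inner_smul_right, inner_gaussianLp_gaussianLp,
        Complex.conj_ofReal, ← Complex.ofReal_mul, r]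
      congr 1
      rw [mul_div_assoc', mul_div_assoc', ← Real.mul_rpow (by positivity) (by positivity),
        ← Real.mul_rpow (by positivity) (by positivity)]
      congr 2
      rw [hsq]
      field_simp
      ring)
    (fun p q => by
      have hp := p.2.out
      have hq := q.2.out
      simp only [e', inner_smul_left, inner_smul_right, inner_gaussianLp_gaussianLp,
        Complex.conj_ofReal, ← Complex.ofReal_mul, r]
      congr 1
      rw [mul_div_assoc', mul_div_assoc', ← Real.mul_rpow (by positivity) (by positivity),
        ← Real.mul_rpow (by positivity) (by positivity)]
      congr 2
      rw [hsq]
      field_simp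
      ring)
    (eq_zero_of_forall_inner_gaussianLp_eq_zero hγ1) (h2.toLp g)
  set K : ℝ := besselConst γ / |b| ^ (γ + 1) with hK
  have hbdd : ∀ p, 0 < p → Integrable (fun t => (gaussian p t : ℂ) * (K * hankel γ b g t))
      (besselMeasure γ) := fun p hp =>
    ((integrable_gaussian hγ1 hp).ofReal (𝕜 := ℂ)).mul_bdd (c := |K| * ∫ s, ‖g s‖ ∂(besselMeasure γ))
      (continuous_const.mul (continuous_hankel hγ b h1)).aestronglyMeasurable
      (Eventually.of_forall fun t => by
        rw [norm_mul, Complex.norm_real]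
        exact mul_le_mul_of_nonneg_left (norm_hankel_le hγ b t h1) (norm_nonneg _))
  -- The abstract image `F` and the concrete transform have the same integrals against every
  -- Gaussian. At this stage the latter is only known to be bounded, which suffices for totality.
  have hae : (fun t => F t - K * hankel γ b g t) =ᵐ[besselMeasure γ] 0 := by
    have hsub : ∀ p, 0 < p → Integrable (fun t => (gaussian p t : ℂ) * F t) (besselMeasure γ) :=
      fun p hp => integrable_gaussian_mul hγ1 hp (Lp.memLp F)
    refine ae_eq_zero_of_forall_integral_gaussian_mul_eq_zero ?_ fun q hq => ?_
    · simp_rw [mul_sub]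
      exact (hsub 1 one_pos).sub (hbdd 1 one_pos)
    · simp_rw [mul_sub]
      rw [integral_sub (hsub q hq) (hbdd q hq), sub_eq_zero]
      have hFq := hF ⟨q, hq⟩
      rw [inner_gaussianLp, inner_smul_left, inner_gaussianLp, Complex.conj_ofReal] at hFq
      rw [hFq]
      simp_rw [mul_left_comm _ (K : ℂ)]
      rw [integral_const_mul, integral_gaussian_mul_hankel hγ hb hq h1, ← mul_assoc,
        ← Complex.ofReal_mul]
      congr 1
      · congr 1
        rw [hK, Real.mul_rpow hb'.le hq.le, Real.rpow_neg hb'.le]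
        field_simp
      · refine integral_congr_ae ?_
        filter_upwards [h2.coeFn_toLp] with s hs
        rw [hs]
  calc eLpNorm (fun t => (K : ℂ) * hankel γ b g t) 2 (besselMeasure γ)
      = eLpNorm F 2 (besselMeasure γ) := by
        refine (eLpNorm_congr_ae ?_).symm
        filter_upwards [hae] with t ht
        exact sub_eq_zero.1 ht
    _ = eLpNorm g 2 (besselMeasure γ) := by
        rw [← Lp.enorm_def, ← eLpNorm_congr_ae h2.coeFn_toLp, ← Lp.enorm_def,
          ← ofReal_norm, hFn, ofReal_norm]

/-! ### The quadratic-phase transform on `L¹_γ ∩ L²_γ` -/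

variable {a b c d e γ : ℝ}

/-- The unimodular factor `exp(-i(a s² + d s))`. -/
noncomputable def chirp (a d s : ℝ) : ℂ :=
  Complex.exp (-Complex.I * ((a * s ^ 2 + d * s : ℝ) : ℂ))

lemma norm_chirp (a d s : ℝ) : ‖chirp a d s‖ = 1 := by
  rw [chirp, neg_mul, mul_comm, ← neg_mul, ← Complex.ofReal_neg, Complex.norm_exp_ofReal_mul_I]

@[fun_prop]
lemma continuous_chirp (a d : ℝ) : Continuous (chirp a d) := by unfold chirp; fun_prop

lemma eLpNorm_chirp_mul (a d : ℝ) (g : ℝ → ℂ) (p : ENNReal) (μ : Measure ℝ) :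
    eLpNorm (fun s => chirp a d s * g s) p μ = eLpNorm g p μ :=
  eLpNorm_congr_norm_ae (Eventually.of_forall fun s => by rw [norm_mul, norm_chirp, one_mul])

lemma memLp_chirp_mul (a d : ℝ) {g : ℝ → ℂ} {p : ENNReal} {μ : Measure ℝ} (hg : MemLp g p μ) :
    MemLp (fun s => chirp a d s * g s) p μ :=
  ⟨(continuous_chirp a d).aestronglyMeasurable.mul hg.1, by
    rw [eLpNorm_chirp_mul]; exact hg.2⟩

lemma kernel_mul_eq (a b c d e γ t s : ℝ) (z : ℂ) :
    kernel a b c d e γ t s * z =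
      chirp c e t * ((normalizedBessel γ (s * t / b) : ℂ) * (chirp a d s * z)) := by
  have : kernel a b c d e γ t s =
      chirp c e t * chirp a d s * (normalizedBessel γ (s * t / b) : ℂ) := by
    rw [kernel, chirp, chirp, ← Complex.exp_add]
    congr 2
    push_cast
    ring
  rw [this]
  ring

/-- The phase splits into a factor in `t` and a factor in `s`, both unimodular, so norm questions
reduce to the Hankel transform. -/
lemma transformL1_eq (a b c d e γ : ℝ) (g : ℝ → ℂ) (t : ℝ) :
    transformL1 a b c d e γ g t =
      (besselConst γ : ℂ) / (Complex.I * (b : ℂ)) ^ ((γ : ℂ) + 1) *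
        (chirp c e t * hankel γ b (fun s => chirp a d s * g s) t) := by
  simp_rw [transformL1, kernel_mul_eq]
  rw [integral_const_mul, hankel]

lemma norm_transformL1 (hγ : -1 < γ) (g : ℝ → ℂ) (t : ℝ) :
    ‖transformL1 a b c d e γ g t‖ =
      besselConst γ / |b| ^ (γ + 1) * ‖hankel γ b (fun s => chirp a d s * g s) t‖ := by
  rw [transformL1_eq, norm_mul, norm_mul, norm_chirp, one_mul, norm_div, Complex.norm_real,
    Real.norm_of_nonneg (besselConst_pos hγ).le,
    show (γ : ℂ) + 1 = ((γ + 1 : ℝ) : ℂ) by push_cast; rfl, Complex.norm_cpow_real, norm_mul,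
    Complex.norm_I, one_mul, Complex.norm_real, Real.norm_eq_abs]

lemma integrable_chirp_mul {g : ℝ → ℂ} (hg : MemLp g 1 (besselMeasure γ)) :
    Integrable (fun s => chirp a d s * g s) (besselMeasure γ) :=
  memLp_one_iff_integrable.1 (memLp_chirp_mul a d hg)

lemma norm_transformL1_le (hγ : -1 / 2 < γ) {g : ℝ → ℂ} (hg : MemLp g 1 (besselMeasure γ))
    (t : ℝ) :
    ‖transformL1 a b c d e γ g t‖ ≤
      besselConst γ / |b| ^ (γ + 1) * ∫ s, ‖g s‖ ∂(besselMeasure γ) := by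
  have hγ1 : -1 < γ := by linarith
  have := besselConst_pos hγ1
  rw [norm_transformL1 hγ1]
  refine mul_le_mul_of_nonneg_left ?_ (by positivity)
  refine (norm_hankel_le hγ b t (integrable_chirp_mul hg)).trans_eq ?_
  simp_rw [norm_mul, norm_chirp, one_mul]

lemma continuous_transformL1 (hγ : -1 / 2 < γ) {g : ℝ → ℂ} (hg : MemLp g 1 (besselMeasure γ)) :
    Continuous (transformL1 a b c d e γ g) := by
  have := continuous_hankel hγ b (integrable_chirp_mul (a := a) (d := d) hg)
  rw [funext (transformL1_eq a b c d e γ g)]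
  fun_prop

/-- Plancherel's theorem on `L¹_γ ∩ L²_γ`. -/
lemma eLpNorm_transformL1 (hγ : -1 / 2 < γ) (hb : b ≠ 0) {g : ℝ → ℂ}
    (h1 : MemLp g 1 (besselMeasure γ)) (h2 : MemLp g 2 (besselMeasure γ)) :
    eLpNorm (transformL1 a b c d e γ g) 2 (besselMeasure γ) = eLpNorm g 2 (besselMeasure γ) := by
  have hγ1 : -1 < γ := by linarith
  have := besselConst_pos hγ1
  rw [← eLpNorm_chirp_mul a d g, ← hankel_plancherel hγ hb (integrable_chirp_mul h1)
    (memLp_chirp_mul a d h2)]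
  refine eLpNorm_congr_norm_ae (Eventually.of_forall fun t => ?_)
  rw [norm_transformL1 hγ1, norm_mul, Complex.norm_real, Real.norm_of_nonneg (by positivity)]

lemma memLp_transformL1 (hγ : -1 / 2 < γ) (hb : b ≠ 0) {g : ℝ → ℂ}
    (h1 : MemLp g 1 (besselMeasure γ)) (h2 : MemLp g 2 (besselMeasure γ)) :
    MemLp (transformL1 a b c d e γ g) 2 (besselMeasure γ) :=
  ⟨(continuous_transformL1 hγ h1).aestronglyMeasurable, by
    rw [eLpNorm_transformL1 hγ hb h1 h2]; exact h2.2⟩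

lemma transformL1_sub (hγ : -1 / 2 < γ) {f g : ℝ → ℂ}
    (hf : MemLp f 1 (besselMeasure γ)) (hg : MemLp g 1 (besselMeasure γ)) :
    transformL1 a b c d e γ (f - g) =
      transformL1 a b c d e γ f - transformL1 a b c d e γ g := by
  funext t
  simp only [Pi.sub_apply, transformL1_eq, ← mul_sub]
  congr 2
  simp only [hankel, mul_sub]
  exact integral_sub (integrable_normalizedBessel_mul hγ b t (integrable_chirp_mul hf))
    (integrable_normalizedBessel_mul hγ b t (integrable_chirp_mul hg))

lemma eLpNorm_transformL1_sub (hγ : -1 / 2 < γ) (hb : b ≠ 0) {f g : ℝ → ℂ}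
    (hf1 : MemLp f 1 (besselMeasure γ)) (hf2 : MemLp f 2 (besselMeasure γ))
    (hg1 : MemLp g 1 (besselMeasure γ)) (hg2 : MemLp g 2 (besselMeasure γ)) :
    eLpNorm (transformL1 a b c d e γ f - transformL1 a b c d e γ g) 2 (besselMeasure γ) =
      eLpNorm (f - g) 2 (besselMeasure γ) := by
  rw [← transformL1_sub hγ hf1 hg1, eLpNorm_transformL1 hγ hb (hf1.sub hg1) (hf2.sub hg2)]

/-! ### Extension to `L²_γ` -/

/-- The transform extends to all of `L²_γ`. -/
lemma exists_isL2Transform (hγ : -1 / 2 < γ) (hb : b ≠ 0) {h : ℝ → ℂ}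
    (hh : MemLp h 2 (besselMeasure γ)) : ∃ F, IsL2Transform a b c d e γ h F := by
  have happrox : ∀ n : ℕ, ∃ g : ℝ → ℂ, MemLp g 1 (besselMeasure γ) ∧
      MemLp g 2 (besselMeasure γ) ∧
      eLpNorm (g - h) 2 (besselMeasure γ) ≤ ENNReal.ofReal (1 / (n + 1)) := by
    intro n
    obtain ⟨g, hg, hg2⟩ := hh.exists_simpleFunc_eLpNorm_sub_lt (by simp)
      (ε := ENNReal.ofReal (1 / (n + 1)))
      (by rw [Ne, ENNReal.ofReal_eq_zero, not_le]; positivity)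
    refine ⟨g, ?_, hg2, ?_⟩
    · rw [memLp_one_iff_integrable]
      exact (SimpleFunc.memLp_iff_integrable (by simp) (by simp)).1 hg2
    · rw [← neg_sub, eLpNorm_neg]; exact hg.le
  choose g hg1 hg2 hlim using happrox
  have hzero : Tendsto (fun n : ℕ => ENNReal.ofReal (1 / ((n : ℝ) + 1))) atTop (𝓝 0) := by
    rw [← ENNReal.ofReal_zero]
    exact ENNReal.tendsto_ofReal tendsto_one_div_add_atTop_nhds_zero_nat
  have hgh : Tendsto (fun n => eLpNorm (g n - h) 2 (besselMeasure γ)) atTop (𝓝 0) :=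
    tendsto_of_tendsto_of_tendsto_of_le_of_le tendsto_const_nhds hzero
      (fun _ => zero_le) hlim
  have hT := fun n => memLp_transformL1 (a := a) (c := c) (d := d) (e := e) hγ hb (hg1 n) (hg2 n)
  have hcauchy : CauchySeq fun n => (hT n).toLp _ := by
    have h1 : CauchySeq fun n => (hg2 n).toLp _ :=
      ((Lp.tendsto_Lp_iff_tendsto_eLpNorm'' g hg2 h hh).2 hgh).cauchySeq
    rw [EMetric.cauchySeq_iff] at h1 ⊢
    intro ε hε
    obtain ⟨N, hN⟩ := h1 ε hε
    refine ⟨N, fun m hm n hn => ?_⟩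
    rw [Lp.edist_toLp_toLp, eLpNorm_transformL1_sub hγ hb (hg1 m) (hg2 m) (hg1 n) (hg2 n),
      ← Lp.edist_toLp_toLp _ _ (hg2 m) (hg2 n)]
    exact hN m hm n hn
  obtain ⟨F, hF⟩ := cauchySeq_tendsto_of_complete hcauchy
  refine ⟨F, Lp.memLp F, g, fun n => ⟨hg1 n, hg2 n⟩, hgh, ?_⟩
  rw [← Lp.toLp_coeFn F (Lp.memLp F)] at hF
  exact (Lp.tendsto_Lp_iff_tendsto_eLpNorm'' _ hT _ (Lp.memLp F)).1 hF

lemma isL2Transform_transform (hγ : -1 / 2 < γ) (hb : b ≠ 0) {h : ℝ → ℂ}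
    (hh : MemLp h 2 (besselMeasure γ)) :
    IsL2Transform a b c d e γ h (transform a b c d e γ h) := by
  have H := exists_isL2Transform (a := a) (c := c) (d := d) (e := e) hγ hb hh
  rw [transform, dif_pos H]
  exact Classical.choose_spec H

lemma tendsto_eLpNorm_of_tendsto_sub {α : Type*} [MeasurableSpace α] {μ : Measure α}
    {g : ℕ → α → ℂ} {h : α → ℂ} (hg : ∀ n, MemLp (g n) 2 μ) (hh : MemLp h 2 μ)
    (H : Tendsto (fun n => eLpNorm (g n - h) 2 μ) atTop (𝓝 0)) :
    Tendsto (fun n => eLpNorm (g n) 2 μ) atTop (𝓝 (eLpNorm h 2 μ)) := by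
  have := ((Lp.tendsto_Lp_iff_tendsto_eLpNorm'' g hg h hh).2 H).enorm
  simpa only [Lp.enorm_toLp] using this

/-- Plancherel's theorem, for the difference of a function in `L²_γ` and one in `L¹_γ ∩ L²_γ`. -/
lemma IsL2Transform.eLpNorm_sub_transformL1 (hγ : -1 / 2 < γ) (hb : b ≠ 0) {h F u : ℝ → ℂ}
    (hh : MemLp h 2 (besselMeasure γ)) (hF : IsL2Transform a b c d e γ h F)
    (hu1 : MemLp u 1 (besselMeasure γ)) (hu2 : MemLp u 2 (besselMeasure γ)) :
    eLpNorm (F - transformL1 a b c d e γ u) 2 (besselMeasure γ) =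
      eLpNorm (h - u) 2 (besselMeasure γ) := by
  obtain ⟨hF2, g, hg, hgh, hgF⟩ := hF
  have hTu := memLp_transformL1 (a := a) (c := c) (d := d) (e := e) hγ hb hu1 hu2
  -- The isometry holds for `g n - u`, and both sides pass to the limit; linearity of the extension
  -- itself is not needed.
  have h1 := tendsto_eLpNorm_of_tendsto_sub (fun n => (hg n).2.sub hu2) (hh.sub hu2)
    (by simpa only [sub_sub_sub_cancel_right] using hgh)
  have h2 := tendsto_eLpNorm_of_tendsto_sub
    (fun n => (memLp_transformL1 hγ hb (hg n).1 (hg n).2).sub hTu) (hF2.sub hTu)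
    (by simpa only [sub_sub_sub_cancel_right] using hgF)
  refine tendsto_nhds_unique h2 ?_
  simpa only [eLpNorm_transformL1_sub hγ hb (hg _).1 (hg _).2 hu1 hu2] using h1

/-- Plancherel's theorem on `L²_γ`. -/
lemma IsL2Transform.eLpNorm_eq (hγ : -1 / 2 < γ) (hb : b ≠ 0) {h F : ℝ → ℂ}
    (hh : MemLp h 2 (besselMeasure γ)) (hF : IsL2Transform a b c d e γ h F) :
    eLpNorm F 2 (besselMeasure γ) = eLpNorm h 2 (besselMeasure γ) := by
  have h0 : transformL1 a b c d e γ 0 = 0 := by funext t; simp [transformL1]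
  have := hF.eLpNorm_sub_transformL1 hγ hb hh MemLp.zero MemLp.zero
  rwa [h0, sub_zero, sub_zero] at this

/-! ### The uncertainty inequality -/

lemma eLpNorm_indicator_transformL1_le (hγ : -1 / 2 < γ) {g : ℝ → ℂ}
    (hg : MemLp g 1 (besselMeasure γ)) {N : Set ℝ} (hN : MeasurableSet N) :
    eLpNorm (N.indicator (transformL1 a b c d e γ g)) 2 (besselMeasure γ) ≤
      ENNReal.ofReal (besselConst γ / |b| ^ (γ + 1)) * eLpNorm g 1 (besselMeasure γ) *
        besselMeasure γ N ^ (1 / 2 : ℝ) := by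
  have := besselConst_pos (by linarith : -1 < γ)
  have hbound := fun t => norm_transformL1_le (a := a) (b := b) (c := c) (d := d) (e := e) hγ hg t
  rw [eLpNorm_indicator_eq_eLpNorm_restrict hN]
  refine (eLpNorm_le_of_ae_bound (Eventually.of_forall hbound)).trans_eq ?_
  rw [ENNReal.ofReal_mul (by positivity), ofReal_integral_norm_eq_lintegral_enorm
    (memLp_one_iff_integrable.1 hg), eLpNorm_one_eq_lintegral_enorm, Measure.restrict_apply_univ,
    mul_comm]
  norm_num

/-- Cauchy–Schwarz on `M`. -/
lemma eLpNorm_indicator_one_le {h : ℝ → ℂ} (hh : MemLp h 2 (besselMeasure γ)) {M : Set ℝ}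
    (hM : MeasurableSet M) :
    eLpNorm (M.indicator h) 1 (besselMeasure γ) ≤
      eLpNorm h 2 (besselMeasure γ) * besselMeasure γ M ^ (1 / 2 : ℝ) := by
  rw [eLpNorm_indicator_eq_eLpNorm_restrict hM]
  refine (eLpNorm_le_eLpNorm_mul_rpow_measure_univ (p := 1) (q := 2) (by norm_num)
    hh.1.restrict).trans ?_
  rw [Measure.restrict_apply_univ]
  norm_num
  gcongr
  exact Measure.restrict_le_self

/-- The uncertainty principle before squaring, for a set `M` of finite measure. -/
lemma one_le_add_of_isLimited (hγ : -1 / 2 < γ) (hb : b ≠ 0) {M N : Set ℝ}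
    (hM : MeasurableSet M) (hN : MeasurableSet N) (hMtop : besselMeasure γ M ≠ ⊤) {εM εN : ℝ}
    {h : ℝ → ℂ} (hh : MemLp h 2 (besselMeasure γ)) (hnorm : eLpNorm h 2 (besselMeasure γ) = 1)
    (htime : IsTimeLimited γ εM M h) (hband : IsBandLimited a b c d e γ εN N h) :
    1 ≤ ENNReal.ofReal εN + (ENNReal.ofReal εM + ENNReal.ofReal (besselConst γ / |b| ^ (γ + 1)) *
      (besselMeasure γ M * besselMeasure γ N) ^ (1 / 2 : ℝ)) := by
  set F := transform a b c d e γ h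
  have hF : IsL2Transform a b c d e γ h F := isL2Transform_transform hγ hb hh
  set u := M.indicator h
  have hu2 : MemLp u 2 (besselMeasure γ) := hh.indicator hM
  have hule := eLpNorm_indicator_one_le hh hM
  rw [hnorm, one_mul] at hule
  -- Finite `|M|` puts `u` in `L¹_γ`, so its transform is the actual integral and the sup bound
  -- applies.
  have hu1 : MemLp u 1 (besselMeasure γ) :=
    ⟨hu2.1, hule.trans_lt (ENNReal.rpow_lt_top_of_nonneg (by norm_num) hMtop)⟩
  set T := transformL1 a b c d e γ u
  have hT : MemLp T 2 (besselMeasure γ) := memLp_transformL1 hγ hb hu1 hu2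
  have hFN : MemLp (N.indicator F) 2 (besselMeasure γ) := hF.1.indicator hN
  calc 1 = eLpNorm F 2 (besselMeasure γ) := by rw [hF.eLpNorm_eq hγ hb hh, hnorm]
    _ = eLpNorm ((F - N.indicator F) + (N.indicator (F - T) + N.indicator T)) 2
          (besselMeasure γ) := by
        rw [← Set.indicator_add', sub_add_cancel, sub_add_cancel]
    _ ≤ eLpNorm (F - N.indicator F) 2 (besselMeasure γ) +
          (eLpNorm (N.indicator (F - T)) 2 (besselMeasure γ) +
            eLpNorm (N.indicator T) 2 (besselMeasure γ)) := by
        have hNFT := ((hF.1.sub hT).indicator hN).1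
        have hNT := (hT.indicator hN).1
        refine (eLpNorm_add_le (hF.1.1.sub hFN.1) (hNFT.add hNT) (by norm_num)).trans ?_
        gcongr
        exact eLpNorm_add_le hNFT hNT (by norm_num)
    _ ≤ _ := by
        gcongr
        · exact hband.2
        · exact (eLpNorm_indicator_le _).trans
            ((hF.eLpNorm_sub_transformL1 hγ hb hh hu1 hu2).trans_le htime.2)
        · refine (eLpNorm_indicator_transformL1_le hγ hu1 hN).trans ?_
          rw [ENNReal.mul_rpow_of_nonneg _ _ (by norm_num), ← mul_assoc]
          gcongr

/-- A normalized function limited to a null set has `ε ≥ 1`. -/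
lemma IsLimited.one_le_of_measure_eq_zero {ε : ℝ} {S : Set ℝ} {f : ℝ → ℂ}
    (hf : IsLimited γ ε S f) (hnorm : eLpNorm f 2 (besselMeasure γ) = 1)
    (hS : besselMeasure γ S = 0) : 1 ≤ ε := by
  have h1 := hf.2
  have : f - S.indicator f =ᵐ[besselMeasure γ] f := by
    filter_upwards [measure_eq_zero_iff_ae_notMem.1 hS] with s hs
    simp [Set.indicator_of_notMem hs]
  rw [eLpNorm_congr_ae this, hnorm] at h1
  exact ENNReal.one_le_ofReal.1 h1

end QPFB

theorem mainTheorem1 (a b c d e γ : ℝ) (hb : b ≠ 0) (hγ : -1 / 2 < γ)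
    (M N : Set ℝ) (hM : MeasurableSet M) (hN : MeasurableSet N)
    (hM₀ : M ⊆ Set.Ici 0) (hN₀ : N ⊆ Set.Ici 0)
    (εM εN : ℝ) (hε : εM + εN ≤ 1)
    (h : ℝ → ℂ) (hL2 : MemLp h 2 (QPFB.besselMeasure γ))
    (hnorm : eLpNorm h 2 (QPFB.besselMeasure γ) = 1)
    (htime : QPFB.IsTimeLimited γ εM M h)
    (hband : QPFB.IsBandLimited a b c d e γ εN N h) :
    ENNReal.ofReal (|b| ^ (2 * (γ + 1)) / QPFB.besselConst γ ^ 2 * (1 - εM - εN) ^ 2) ≤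
      QPFB.besselMeasure γ M * QPFB.besselMeasure γ N := by
  have hc := QPFB.besselConst_pos (by linarith : -1 < γ)
  have hb' : 0 < |b| := abs_pos.2 hb
  have hεM := htime.1
  have hεN := hband.1
  -- Both `ε` are nonnegative with sum at most one, so if one of them reaches 1 the lower bound
  -- vanishes. This settles null `M` or `N`, including the products `0 · ∞`.
  have htriv : 1 ≤ εM ∨ 1 ≤ εN → ENNReal.ofReal
      (|b| ^ (2 * (γ + 1)) / QPFB.besselConst γ ^ 2 * (1 - εM - εN) ^ 2) = 0 := by
    intro H
    have : 1 - εM - εN = 0 := by rcases H with H | H <;> linarith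
    simp [this]
  by_cases hM0 : QPFB.besselMeasure γ M = 0
  · rw [htriv (Or.inl (QPFB.IsLimited.one_le_of_measure_eq_zero htime hnorm hM0))]
    exact zero_le
  by_cases hN0 : QPFB.besselMeasure γ N = 0
  · rw [htriv (Or.inr (QPFB.IsLimited.one_le_of_measure_eq_zero hband (by
      rw [(QPFB.isL2Transform_transform hγ hb hL2).eLpNorm_eq hγ hb hL2, hnorm]) hN0))]
    exact zero_le
  by_cases hMN : QPFB.besselMeasure γ M * QPFB.besselMeasure γ N = ⊤
  · rw [hMN]; exact le_top
  -- With `N` not null, an infinite `|M|` would make the product infinite.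
  have hMtop : QPFB.besselMeasure γ M ≠ ⊤ := fun H => hMN (by rw [H, ENNReal.top_mul hN0])
  have key := QPFB.one_le_add_of_isLimited hγ hb hM hN hMtop hL2 hnorm htime hband
  set X := QPFB.besselMeasure γ M * QPFB.besselMeasure γ N
  have hX : X = ENNReal.ofReal X.toReal := (ENNReal.ofReal_toReal hMN).symm
  rw [hX, ENNReal.ofReal_rpow_of_nonneg ENNReal.toReal_nonneg (by norm_num),
    ← ENNReal.ofReal_mul (by positivity), ← ENNReal.ofReal_add hεM (by positivity),
    ← ENNReal.ofReal_add hεN (by positivity), ENNReal.one_le_ofReal, ← Real.sqrt_eq_rpow] at key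
  rw [hX]
  refine ENNReal.ofReal_le_ofReal ?_
  have hle : 1 - εM - εN ≤ QPFB.besselConst γ / |b| ^ (γ + 1) * √X.toReal := by linarith
  have hsq := pow_le_pow_left₀ (by linarith) hle 2
  rw [mul_pow, Real.sq_sqrt ENNReal.toReal_nonneg, div_pow] at hsq
  have hpow : |b| ^ (2 * (γ + 1)) = (|b| ^ (γ + 1)) ^ 2 := by
    rw [mul_comm, Real.rpow_mul hb'.le, Real.rpow_two]
  have hpos : 0 < |b| ^ (γ + 1) := Real.rpow_pos_of_pos hb' _
  rw [hpow]
  calc (|b| ^ (γ + 1)) ^ 2 / QPFB.besselConst γ ^ 2 * (1 - εM - εN) ^ 2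
      ≤ (|b| ^ (γ + 1)) ^ 2 / QPFB.besselConst γ ^ 2 *
          (QPFB.besselConst γ ^ 2 / (|b| ^ (γ + 1)) ^ 2 * X.toReal) := by gcongr
    _ = X.toReal := by field_simp
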